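/- Let $\mathbf C\subset[0,1]$ be the middle-third Cantor set, let $s=\log_3 2$, let $\mathcal R=\bigcup\{\mathbf C+k/3^n : k,n\in\mathbb Z\}\subset\mathbb R$, and let $\mathfrak H^s$ be the $s$-dimensional Hausdorff measure restricted to $\mathcal R$. On the complex Hilbert space $L^2(\mathcal R,\mathfrak H^s)$ consider the unitary operators $Uf(x)=\frac1{\sqrt2}f\left(\frac x3\right)$ and $Tf(x)=f(x-1)$. Put $\pi(f)=f(T)$ (functional calculus of $T$, so that $\pi(z^n)=T^n$), let $m_0(z)=\frac1{\sqrt2}(1+z^2)$ for $|z|=1$, and let $M=U^{-1}\pi(m_0)$ be the cascade operator, i.e. $M\xi(x)=\xi(3x)+\xi(3x-2)$. Let $\xi\in L^2(\mathcal R,\mathfrak H^s)$ have bounded support (that is, $\xi=0$ $\mathfrak H^s$-almost everywhere outside some bounded set), and suppose that $\xi$ is not ($\mathfrak H^s$-almost everywhere) a constant multiple of the characteristic function $\chi_{\mathbf C}$. Then there is a constant $c_\xi>0$ such that $$\lim_{n\to\infty}\|M^{n+1}\xi-M^n\xi\|^2=c_\xi .$$ In particular, the sequence $(M^n\xi)_{n\in\mathbb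 N}$ does not converge in $L^2(\mathcal R,\mathfrak H^s)$. -/

import Mathlib

open MeasureTheory Filter Topology
open scoped ENNReal NNReal

noncomputable section

namespace CantorWavelet

/-- The set `𝓡 = ⋃ {C + k / 3 ^ n : k, n ∈ ℤ}`, where `C` is the middle-third Cantor set. -/
def cantorR : Set ℝ :=
  ⋃ (k : ℤ) (n : ℤ), (fun x : ℝ => x + (k : ℝ) / (3 : ℝ) ^ n) '' cantorSet

/-- The Hausdorff dimension `s = log₃ 2` of the Cantor set. -/
def cantorDim : ℝ := Real.logb 3 2

/-- The Hausdorff measure `𝔥^s` of dimension `s = log₃ 2`, restricted to `𝓡`. -/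
def cantorMeasure : Measure ℝ := (Measure.hausdorffMeasure cantorDim).restrict cantorR

/-- The complex Hilbert space `L²(𝓡, 𝔥^s)`. -/
abbrev CantorL2 : Type := Lp ℂ 2 cantorMeasure

/-! ### Weighted composition operators -/

section WeightedComp

variable {μ : Measure ℝ}

theorem eLpNorm_comp_equiv (e : ℝ ≃ᵐ ℝ) (w : ℝ) (hw : 0 < w)
    (h : μ.map e = ENNReal.ofReal (w⁻¹ ^ 2) • μ) (f : ℝ → ℂ) (hf : AEStronglyMeasurable f μ) :
    eLpNorm (fun x => (w : ℂ) * f (e x)) 2 μ = eLpNorm f 2 μ := by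
  have hf' : AEStronglyMeasurable f (μ.map e) := by
    rw [h]; exact hf.smul_measure _
  have h1 : eLpNorm (f ∘ e) 2 μ = ENNReal.ofReal w⁻¹ * eLpNorm f 2 μ := by
    rw [← eLpNorm_map_measure hf' e.measurable.aemeasurable, h,
      eLpNorm_smul_measure_of_ne_top (by simp)]
    congr 1
    rw [ENNReal.ofReal_rpow_of_nonneg (by positivity) (by positivity)]
    congr 1
    rw [← Real.rpow_natCast, ← Real.rpow_mul (by positivity)]
    norm_num
  have h2 : (fun x => (w : ℂ) * f (e x)) = (w : ℂ) • (f ∘ e) := by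
    ext x; simp
  rw [h2, eLpNorm_const_smul, h1, ← mul_assoc]
  have h3 : ‖(w : ℂ)‖ₑ * ENNReal.ofReal w⁻¹ = 1 := by
    rw [← ofReal_norm, ← ENNReal.ofReal_mul (norm_nonneg _)]
    simp [abs_of_pos hw, hw.ne']
  rw [h3, one_mul]

theorem memLp_comp_equiv (e : ℝ ≃ᵐ ℝ) (w : ℝ) (hw : 0 < w)
    (h : μ.map e = ENNReal.ofReal (w⁻¹ ^ 2) • μ) (f : Lp ℂ 2 μ) :
    MemLp (fun x => (w : ℂ) * f (e x)) 2 μ := by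
  have hf : MemLp f 2 μ := Lp.memLp f
  refine ⟨?_, ?_⟩
  · have hf' : AEStronglyMeasurable f (μ.map e) := by
      rw [h]; exact hf.1.smul_measure _
    exact (hf'.comp_aemeasurable e.measurable.aemeasurable).const_mul _
  · rw [eLpNorm_comp_equiv e w hw h f hf.1]
    exact hf.2

theorem ae_comp_equiv (e : ℝ ≃ᵐ ℝ) (w : ℝ)
    (h : μ.map e = ENNReal.ofReal (w⁻¹ ^ 2) • μ) {p : ℝ → Prop} (hp : ∀ᵐ x ∂μ, p x) :
    ∀ᵐ x ∂μ, p (e x) := by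
  have h1 : ∀ᵐ x ∂(μ.map e), p x := by
    rw [h]; exact Measure.ae_smul_measure hp _
  exact ae_of_ae_map e.measurable.aemeasurable h1

theorem map_symm_equiv (e : ℝ ≃ᵐ ℝ) (w : ℝ) (hw : 0 < w)
    (h : μ.map e = ENNReal.ofReal (w⁻¹ ^ 2) • μ) :
    μ.map e.symm = ENNReal.ofReal (w⁻¹⁻¹ ^ 2) • μ := by
  have h1 : μ = ENNReal.ofReal (w⁻¹ ^ 2) • μ.map e.symm := by
    have h2 := congrArg (Measure.map e.symm) h
    rw [e.map_symm_map, Measure.map_smul] at h2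
    exact h2
  conv_rhs => rw [h1]
  rw [smul_smul, ← ENNReal.ofReal_mul (by positivity)]
  have : w⁻¹⁻¹ ^ 2 * w⁻¹ ^ 2 = 1 := by field_simp
  rw [this]; simp

/-- If the measurable bijection `e` satisfies `e_* μ = w⁻² μ`, then `f ↦ w · (f ∘ e)` is a unitary
operator on `L²(μ)`, with inverse `f ↦ w⁻¹ · (f ∘ e⁻¹)`. -/
def weightedComp (e : ℝ ≃ᵐ ℝ) (w : ℝ) (hw : 0 < w)
    (h : μ.map e = ENNReal.ofReal (w⁻¹ ^ 2) • μ) : Lp ℂ 2 μ ≃ₗᵢ[ℂ] Lp ℂ 2 μ where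
  toFun f := (memLp_comp_equiv e w hw h f).toLp _
  invFun f := (memLp_comp_equiv e.symm w⁻¹ (inv_pos.2 hw) (map_symm_equiv e w hw h) f).toLp _
  map_add' f g := by
    apply Lp.ext
    filter_upwards [MemLp.coeFn_toLp (memLp_comp_equiv e w hw h (f + g)),
      MemLp.coeFn_toLp (memLp_comp_equiv e w hw h f),
      MemLp.coeFn_toLp (memLp_comp_equiv e w hw h g),
      Lp.coeFn_add ((memLp_comp_equiv e w hw h f).toLp _) ((memLp_comp_equiv e w hw h g).toLp _),
      ae_comp_equiv e w h (Lp.coeFn_add f g)] with x h1 h2 h3 h4 h5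
    rw [h1, h4, Pi.add_apply, h2, h3, h5, Pi.add_apply, mul_add]
  map_smul' c f := by
    apply Lp.ext
    filter_upwards [MemLp.coeFn_toLp (memLp_comp_equiv e w hw h (c • f)),
      MemLp.coeFn_toLp (memLp_comp_equiv e w hw h f),
      Lp.coeFn_smul c ((memLp_comp_equiv e w hw h f).toLp _),
      ae_comp_equiv e w h (Lp.coeFn_smul c f)] with x h1 h2 h4 h5
    rw [h1, RingHom.id_apply, h4, Pi.smul_apply, h2, h5, Pi.smul_apply, smul_eq_mul, smul_eq_mul,
      mul_left_comm]
  left_inv f := by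
    apply Lp.ext
    filter_upwards [MemLp.coeFn_toLp (memLp_comp_equiv e.symm w⁻¹ (inv_pos.2 hw)
        (map_symm_equiv e w hw h) ((memLp_comp_equiv e w hw h f).toLp _)),
      ae_comp_equiv e.symm w⁻¹ (map_symm_equiv e w hw h)
        (MemLp.coeFn_toLp (memLp_comp_equiv e w hw h f))] with x h1 h2
    rw [h1, h2, MeasurableEquiv.apply_symm_apply, ← mul_assoc, ← Complex.ofReal_mul,
      inv_mul_cancel₀ hw.ne', Complex.ofReal_one, one_mul]
  right_inv f := by
    apply Lp.ext
    filter_upwards [MemLp.coeFn_toLp (memLp_comp_equiv e w hw h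
        ((memLp_comp_equiv e.symm w⁻¹ (inv_pos.2 hw) (map_symm_equiv e w hw h) f).toLp _)),
      ae_comp_equiv e w h (MemLp.coeFn_toLp (memLp_comp_equiv e.symm w⁻¹ (inv_pos.2 hw)
        (map_symm_equiv e w hw h) f))] with x h1 h2
    rw [h1, h2, MeasurableEquiv.symm_apply_apply, ← mul_assoc, ← Complex.ofReal_mul,
      mul_inv_cancel₀ hw.ne', Complex.ofReal_one, one_mul]
  norm_map' f := by
    change ‖(memLp_comp_equiv e w hw h f).toLp _‖ = ‖f‖
    rw [Lp.norm_toLp, eLpNorm_comp_equiv e w hw h f (Lp.memLp f).1, Lp.norm_def]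

theorem coeFn_weightedComp (e : ℝ ≃ᵐ ℝ) (w : ℝ) (hw : 0 < w)
    (h : μ.map e = ENNReal.ofReal (w⁻¹ ^ 2) • μ) (f : Lp ℂ 2 μ) :
    weightedComp e w hw h f =ᵐ[μ] fun x => (w : ℂ) * f (e x) :=
  MemLp.coeFn_toLp (memLp_comp_equiv e w hw h f)

end WeightedComp

/-! ### Invariance of `𝓡` and of the measure -/

theorem mem_cantorR {x : ℝ} :
    x ∈ cantorR ↔ ∃ k n : ℤ, x - (k : ℝ) / (3 : ℝ) ^ n ∈ cantorSet := by
  simp only [cantorR, Set.mem_iUnion, Set.mem_image]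
  constructor
  · rintro ⟨k, n, y, hy, rfl⟩
    exact ⟨k, n, by simpa using hy⟩
  · rintro ⟨k, n, h⟩
    exact ⟨k, n, _, h, by ring⟩

theorem add_int_mem_cantorR {x : ℝ} (m : ℤ) (hx : x ∈ cantorR) : x + m ∈ cantorR := by
  rw [mem_cantorR] at hx ⊢
  obtain ⟨k, n, h⟩ := hx
  rcases le_total 0 n with hn | hn
  · obtain ⟨n, rfl⟩ := Int.eq_ofNat_of_zero_le hn
    refine ⟨k + m * 3 ^ n, n, ?_⟩
    convert h using 1
    push_cast
    rw [zpow_natCast]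
    field_simp
    ring
  · obtain ⟨j, rfl⟩ : ∃ j : ℕ, n = -j := ⟨n.natAbs, by omega⟩
    refine ⟨k * 3 ^ j + m, 0, ?_⟩
    convert h using 1
    push_cast
    rw [zpow_neg, zpow_natCast, zpow_zero]
    field_simp
    ring

theorem div_three_mem_cantorR {x : ℝ} (hx : x ∈ cantorR) : x / 3 ∈ cantorR := by
  rw [mem_cantorR] at hx ⊢
  obtain ⟨k, n, h⟩ := hx
  refine ⟨k, n + 1, ?_⟩
  rw [cantorSet_eq_union_halves]
  left
  refine ⟨_, h, ?_⟩
  rw [zpow_add_one₀ (by norm_num)]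
  field_simp

theorem mul_three_mem_cantorR {x : ℝ} (hx : x ∈ cantorR) : x * 3 ∈ cantorR := by
  rw [mem_cantorR] at hx
  obtain ⟨k, n, h⟩ := hx
  rw [cantorSet_eq_union_halves] at h
  have key : (k : ℝ) / 3 ^ (n - 1) = 3 * (k / 3 ^ n) := by
    rw [zpow_sub_one₀ (by norm_num)]
    field_simp
  rcases h with ⟨y, hy, hxy⟩ | ⟨y, hy, hxy⟩
  · rw [mem_cantorR]
    refine ⟨k, n - 1, ?_⟩
    convert hy using 1
    rw [key]
    simp only at hxy
    linarith
  · have : x * 3 - 2 ∈ cantorR := by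
      rw [mem_cantorR]
      refine ⟨k, n - 1, ?_⟩
      convert hy using 1
      rw [key]
      simp only at hxy
      linarith
    simpa using add_int_mem_cantorR 2 this

theorem cantorDim_nonneg : 0 ≤ cantorDim :=
  Real.logb_nonneg (by norm_num) (by norm_num)

/-- The translation `x ↦ x - 1` preserves the measure. -/
theorem map_sub_one_cantorMeasure :
    cantorMeasure.map (MeasurableEquiv.addRight (-1 : ℝ)) =
      ENNReal.ofReal ((1 : ℝ)⁻¹ ^ 2) • cantorMeasure := by
  have h1 : (Measure.hausdorffMeasure cantorDim : Measure ℝ).map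
      (MeasurableEquiv.addRight (-1 : ℝ)) = Measure.hausdorffMeasure cantorDim :=
    (IsometryEquiv.addRight (-1 : ℝ)).map_hausdorffMeasure cantorDim
  have h2 : (MeasurableEquiv.addRight (-1 : ℝ)) ⁻¹' cantorR = cantorR := by
    ext x
    simp only [Set.mem_preimage, MeasurableEquiv.coe_addRight]
    constructor
    · intro h; simpa using add_int_mem_cantorR 1 h
    · intro h; simpa using add_int_mem_cantorR (-1) h
  have h3 := MeasurableEquiv.restrict_map (MeasurableEquiv.addRight (-1 : ℝ))
    (Measure.hausdorffMeasure cantorDim) cantorR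
  rw [h1, h2] at h3
  rw [inv_one, one_pow, ENNReal.ofReal_one, one_smul]
  exact h3.symm

/-- The map `x ↦ x / 3` pushes the measure forward to twice itself. -/
theorem map_div_three_cantorMeasure :
    cantorMeasure.map (MeasurableEquiv.mulRight₀ (3 : ℝ)⁻¹ (by norm_num)) =
      ENNReal.ofReal ((1 / √2 : ℝ)⁻¹ ^ 2) • cantorMeasure := by
  have h1 : (Measure.hausdorffMeasure cantorDim : Measure ℝ).map
      (MeasurableEquiv.mulRight₀ (3 : ℝ)⁻¹ (by norm_num)) =
        ENNReal.ofReal ((1 / √2 : ℝ)⁻¹ ^ 2) • Measure.hausdorffMeasure cantorDim := by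
    have h := map_homothety_hausdorffMeasure (P := ℝ) cantorDim_nonneg (0 : ℝ)
      (c := (3 : ℝ)⁻¹) (by norm_num)
    have he : (⇑(MeasurableEquiv.mulRight₀ (3 : ℝ)⁻¹ (by norm_num)) : ℝ → ℝ) =
        AffineMap.homothety (0 : ℝ) (3 : ℝ)⁻¹ := by
      ext x
      simp [AffineMap.homothety_apply, mul_comm]
    rw [he, h]
    have hc : (‖(3 : ℝ)⁻¹‖₊⁻¹ ^ cantorDim : ℝ≥0) = 2 := by
      apply NNReal.eq
      simp [cantorDim, Real.rpow_logb]
    rw [hc]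
    simp
    rfl
  have h2 : (MeasurableEquiv.mulRight₀ (3 : ℝ)⁻¹ (by norm_num)) ⁻¹' cantorR = cantorR := by
    ext x
    simp only [Set.mem_preimage, MeasurableEquiv.coe_mulRight₀, ← div_eq_mul_inv]
    constructor
    · intro h; simpa using mul_three_mem_cantorR h
    · intro h; exact div_three_mem_cantorR h
  have h3 := MeasurableEquiv.restrict_map (MeasurableEquiv.mulRight₀ (3 : ℝ)⁻¹ (by norm_num))
    (Measure.hausdorffMeasure cantorDim) cantorR
  rw [h1, h2, Measure.restrict_smul] at h3
  exact h3.symm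

/-! ### The wavelet representation and the cascade operator -/

/-- The unitary dilation operator `(U f)(x) = (1 / √2) f(x / 3)` on `L²(𝓡, 𝔥^s)`. -/
def dilation : CantorL2 ≃ₗᵢ[ℂ] CantorL2 :=
  weightedComp (MeasurableEquiv.mulRight₀ (3 : ℝ)⁻¹ (by norm_num)) (1 / √2) (by positivity)
    map_div_three_cantorMeasure

/-- The unitary translation operator `(T f)(x) = f(x - 1)` on `L²(𝓡, 𝔥^s)`. -/
def translation : CantorL2 ≃ₗᵢ[ℂ] CantorL2 :=
  weightedComp (MeasurableEquiv.addRight (-1 : ℝ)) 1 one_pos map_sub_one_cantorMeasure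

theorem coeFn_dilation (f : CantorL2) :
    dilation f =ᵐ[cantorMeasure] fun x => (1 / √2 : ℂ) * f (x / 3) := by
  filter_upwards [coeFn_weightedComp (MeasurableEquiv.mulRight₀ (3 : ℝ)⁻¹ (by norm_num)) (1 / √2)
    (by positivity) map_div_three_cantorMeasure f] with x hx
  rw [dilation, hx]
  simp [div_eq_mul_inv]

theorem coeFn_translation (f : CantorL2) :
    translation f =ᵐ[cantorMeasure] fun x => f (x - 1) := by
  filter_upwards [coeFn_weightedComp (MeasurableEquiv.addRight (-1 : ℝ)) 1
    one_pos map_sub_one_cantorMeasure f] with x hx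
  rw [translation, hx]
  simp [sub_eq_add_neg]

/-- The translation operator as an element of the C⋆-algebra of bounded operators. -/
def translationOp : CantorL2 →L[ℂ] CantorL2 :=
  (translation.toContinuousLinearEquiv : CantorL2 →L[ℂ] CantorL2)

/-- `T` is unitary. In particular it is normal with spectrum in the unit circle, so that the
continuous functional calculus of `T` applies to functions that are continuous on the circle. -/
theorem translationOp_mem_unitary :
    translationOp ∈ unitary (CantorL2 →L[ℂ] CantorL2) :=
  (Unitary.linearIsometryEquiv.symm translation).2

/-- The representation `π(f) = f(T)`, given by the functional calculus of the unitary operator `T`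
(so `π(zⁿ) = Tⁿ`), for functions `f` that are continuous on the unit circle. -/
def rep (f : ℂ → ℂ) : CantorL2 →L[ℂ] CantorL2 := cfc f translationOp

/-- The filter `m₀(z) = (1 + z²) / √2`. -/
def filterM0 (z : ℂ) : ℂ := (1 + z ^ 2) / (√2 : ℝ)

/-- `π(m₀) = (1 + T²) / √2`. -/
theorem rep_filterM0 (f : CantorL2) :
    rep filterM0 f = (1 / √2 : ℂ) • (f + translation (translation f)) := by
  have hn : IsStarNormal translationOp := by
    obtain ⟨h1, h2⟩ := Unitary.mem_iff.1 translationOp_mem_unitary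
    exact ⟨h1.trans h2.symm⟩
  have h1 : rep filterM0 = (1 / √2 : ℂ) • (1 + translationOp ^ 2) := by
    have : filterM0 = fun z => (1 / √2 : ℂ) • ((1 : ℂ) + z ^ 2) := by
      ext z; simp [filterM0, div_eq_mul_inv, mul_comm]
    rw [rep, this, cfc_smul _ _ _ (by fun_prop), cfc_add _ _ _ (by fun_prop) (by fun_prop),
      cfc_const_one ℂ translationOp, cfc_pow_id translationOp 2]
  rw [h1]
  simp [pow_two]
  rfl

/-- The cascade operator `M = U⁻¹ π(m₀)`. -/
def cascade : CantorL2 →L[ℂ] CantorL2 :=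
  (dilation.symm.toContinuousLinearEquiv : CantorL2 →L[ℂ] CantorL2) ∘L rep filterM0

/-- `ξ` has bounded support: it vanishes almost everywhere outside some bounded set. -/
def HasBoundedSupport (ξ : CantorL2) : Prop :=
  ∃ K : Set ℝ, Bornology.IsBounded K ∧ ∀ᵐ x ∂cantorMeasure, x ∉ K → ξ x = 0

/-- `ξ` is a constant multiple of the characteristic function of the Cantor set. -/
def IsMultipleOfCantorIndicator (ξ : CantorL2) : Prop :=
  ∃ c : ℂ, ξ =ᵐ[cantorMeasure] fun x => c * cantorSet.indicator (fun _ => (1 : ℂ)) x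

end CantorWavelet

end

namespace CantorWavelet

/-! ### Pointwise description of the operators -/

/-! Write `M` for `cascade`, `T` for `translation`, `U` for `dilation`. The n-th increment is `Mⁿη`
with `η = Mξ - ξ`, again of bounded support, so it suffices that `‖Mⁿη‖` is eventually constant and
that the constant is not zero.

Eventual constancy: the numbers `⟪f, Tᵏf⟫` vanish for large `|k|` when `f` has bounded support. By
`U T U⁻¹ = T³` they transform under `M` by a transfer operator (`correlation_cascade`) which
contracts the range of nonzero indices until only `|k| ≤ 1` survive. From then on the coefficient at
`0`, the squared norm, is unchanged (`exists_norm_pow_cascade_eq`).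

Positivity: `M` is injective on vectors of bounded support (`eq_zero_of_cascade_eq_zero`), since `Mf
= 0` forces `T²f = -f`, and then the correlations of `f` do not decay unless `f = 0`. So a zero
limit would give `Mξ = ξ`.

Fixed vectors: such a vector lives on `C` and is integrable there because `C` has finite measure.
Its distribution function obeys the two-scale relation of the Cantor function, whose solution is
determined by the total mass. Hence it is a multiple of the indicator of `C`
(`isMultipleOfCantorIndicator_of_fixed`). -/

theorem ae_comp_mul_three {p : ℝ → Prop} (hp : ∀ᵐ x ∂cantorMeasure, p x) :
    ∀ᵐ x ∂cantorMeasure, p (3 * x) := by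
  have h := ae_comp_equiv _ _ (map_symm_equiv _ _ (by positivity) map_div_three_cantorMeasure) hp
  filter_upwards [h] with x hx
  have e : (MeasurableEquiv.mulRight₀ (3 : ℝ)⁻¹ (by norm_num)).symm x = 3 * x := by
    rw [MeasurableEquiv.symm_apply_eq]
    simp [mul_comm]
  rwa [e] at hx

theorem ae_comp_sub_one {p : ℝ → Prop} (hp : ∀ᵐ x ∂cantorMeasure, p x) :
    ∀ᵐ x ∂cantorMeasure, p (x - 1) := by
  have h := ae_comp_equiv _ _ map_sub_one_cantorMeasure hp
  filter_upwards [h] with x hx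
  simpa [sub_eq_add_neg] using hx

theorem ae_comp_add_one {p : ℝ → Prop} (hp : ∀ᵐ x ∂cantorMeasure, p x) :
    ∀ᵐ x ∂cantorMeasure, p (x + 1) := by
  have h := ae_comp_equiv _ _ (map_symm_equiv _ _ one_pos map_sub_one_cantorMeasure) hp
  filter_upwards [h] with x hx
  have e : (MeasurableEquiv.addRight (-1 : ℝ)).symm x = x + 1 := by
    rw [MeasurableEquiv.symm_apply_eq]
    simp
  rwa [e] at hx

theorem ae_comp_sub_int (k : ℤ) {p : ℝ → Prop} (hp : ∀ᵐ x ∂cantorMeasure, p x) :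
    ∀ᵐ x ∂cantorMeasure, p (x - k) := by
  have h : ∀ j : ℕ, (∀ᵐ x ∂cantorMeasure, p (x - j)) ∧ ∀ᵐ x ∂cantorMeasure, p (x + j) := by
    intro j
    induction j with
    | zero => simpa using hp
    | succ j ih =>
      constructor
      · filter_upwards [ae_comp_sub_one ih.1] with x hx
        convert hx using 1
        push_cast
        ring
      · filter_upwards [ae_comp_add_one ih.2] with x hx
        convert hx using 1
        push_cast
        ring
  obtain ⟨n, rfl | rfl⟩ := k.eq_nat_or_neg
  · simpa using (h n).1
  · simpa using (h n).2

theorem coeFn_dilation_symm (f : CantorL2) :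
    dilation.symm f =ᵐ[cantorMeasure] fun x => (√2 : ℂ) * f (3 * x) := by
  filter_upwards [ae_comp_mul_three (coeFn_dilation (dilation.symm f))] with x hx
  rw [LinearIsometryEquiv.apply_symm_apply] at hx
  rw [hx, mul_div_cancel_left₀ x (by norm_num), ← mul_assoc, mul_one_div_cancel, one_mul]
  simp

theorem cascade_apply (f : CantorL2) :
    cascade f = dilation.symm ((1 / √2 : ℂ) • (f + translation (translation f))) := by
  rw [← rep_filterM0]
  rfl

theorem coeFn_cascade (f : CantorL2) :
    cascade f =ᵐ[cantorMeasure] fun x => f (3 * x) + f (3 * x - 2) := by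
  have hT : translation (translation f) =ᵐ[cantorMeasure] fun x => f (x - 2) := by
    filter_upwards [coeFn_translation (translation f), ae_comp_sub_one (coeFn_translation f)]
      with x h1 h2
    rw [h1, h2]
    congr 1
    ring
  rw [cascade_apply]
  filter_upwards [coeFn_dilation_symm ((1 / √2 : ℂ) • (f + translation (translation f))),
    ae_comp_mul_three (Lp.coeFn_smul (1 / √2 : ℂ) (f + translation (translation f))),
    ae_comp_mul_three (Lp.coeFn_add f (translation (translation f))),
    ae_comp_mul_three hT] with x h1 h2 h3 h4
  rw [h1, h2, Pi.smul_apply, h3, Pi.add_apply, h4, smul_eq_mul, ← mul_assoc,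
    mul_one_div_cancel, one_mul]
  simp

/-- The covariance relation `U T U⁻¹ = T³`, checked after applying `U`: a unit shift of `x / 3` is a
shift of `x` by `3`. -/
theorem translation_symm_comp_dilation_symm (f : CantorL2) :
    translation (dilation.symm f) = dilation.symm ((translation ^ 3) f) := by
  rw [LinearIsometryEquiv.eq_symm_apply]
  apply Lp.ext
  have h3 : (translation ^ 3) f = translation (translation (translation f)) := rfl
  have hU : ∀ᵐ x ∂cantorMeasure, (dilation.symm f) (x / 3 - 1) = (√2 : ℂ) * f (x - 3) := by
    have h := ae_comp_equiv _ _ map_div_three_cantorMeasure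
      (ae_comp_sub_one (coeFn_dilation_symm f))
    filter_upwards [h] with x hx
    simp only [MeasurableEquiv.coe_mulRight₀, ← div_eq_mul_inv] at hx
    rw [hx]
    congr 2
    ring
  have hT : ∀ᵐ x ∂cantorMeasure, (translation (dilation.symm f)) (x / 3) =
      (dilation.symm f) (x / 3 - 1) := by
    have h := ae_comp_equiv _ _ map_div_three_cantorMeasure
      (coeFn_translation (dilation.symm f))
    filter_upwards [h] with x hx
    simpa only [MeasurableEquiv.coe_mulRight₀, ← div_eq_mul_inv] using hx
  rw [h3]
  filter_upwards [coeFn_dilation (translation (dilation.symm f)), hT, hU,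
    coeFn_translation (translation (translation f)),
    ae_comp_sub_one (coeFn_translation (translation f)),
    ae_comp_sub_one (ae_comp_sub_one (coeFn_translation f))] with x h1 h2 h3 h4 h5 h6
  rw [h1, h2, h3, h4, h5, h6, ← mul_assoc, one_div_mul_cancel, one_mul]
  · congr 1
    ring
  · simp

theorem translation_zpow_dilation_symm (k : ℤ) (f : CantorL2) :
    (translation ^ k) (dilation.symm f) = dilation.symm ((translation ^ (3 * k)) f) := by
  have h : translation * dilation⁻¹ = dilation⁻¹ * translation ^ 3 :=
    LinearIsometryEquiv.ext translation_symm_comp_dilation_symm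
  have h2 : dilation * translation * dilation⁻¹ = translation ^ 3 := by
    rw [mul_assoc, h, mul_inv_cancel_left]
  have h3 : dilation * translation ^ k * dilation⁻¹ = translation ^ (3 * k) := by
    rw [zpow_mul, ← conj_zpow, h2]
    rfl
  rw [← h3]
  change _ = dilation.symm (dilation _)
  rw [LinearIsometryEquiv.symm_apply_apply]
  rfl

theorem coeFn_translation_zpow (k : ℤ) (f : CantorL2) :
    (translation ^ k) f =ᵐ[cantorMeasure] fun x => f (x - k) := by
  have hnat : ∀ (n : ℕ) (g : CantorL2),
      (translation ^ n) g =ᵐ[cantorMeasure] fun x => g (x - n) := by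
    intro n
    induction n with
    | zero => intro g; simp
    | succ n ih =>
      intro g
      have e : (translation ^ (n + 1)) g = translation ((translation ^ n) g) := by
        rw [pow_succ']; rfl
      rw [e]
      filter_upwards [coeFn_translation ((translation ^ n) g), ae_comp_sub_one (ih g)] with x h1 h2
      rw [h1, h2]
      congr 1
      push_cast
      ring
  obtain ⟨n, rfl | rfl⟩ := k.eq_nat_or_neg
  · simpa using hnat n f
  · have h := hnat n ((translation ^ (-(n : ℤ))) f)
    have e : (translation ^ n) ((translation ^ (-(n : ℤ))) f) = f := by
      change (translation ^ n * translation ^ (-(n : ℤ))) f = f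
      rw [zpow_neg, zpow_natCast, mul_inv_cancel]
      rfl
    rw [e] at h
    filter_upwards [ae_comp_sub_int (-n) h] with x hx
    rw [hx]
    congr 1
    push_cast
    ring

/-! ### Supports -/

/-- `f` vanishes almost everywhere outside `S`. -/
def VanishesOff (S : Set ℝ) (f : CantorL2) : Prop :=
  ∀ᵐ x ∂cantorMeasure, x ∉ S → f x = 0

theorem VanishesOff.mono {S S' : Set ℝ} {f : CantorL2} (h : VanishesOff S f) (hS : S ⊆ S') :
    VanishesOff S' f := by
  filter_upwards [h] with x hx hxS using hx fun h => hxS (hS h)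

theorem VanishesOff.sub {S : Set ℝ} {f g : CantorL2} (hf : VanishesOff S f)
    (hg : VanishesOff S g) : VanishesOff S (f - g) := by
  filter_upwards [hf, hg, Lp.coeFn_sub f g] with x h1 h2 h3 hx
  rw [h3, Pi.sub_apply, h1 hx, h2 hx, sub_zero]

theorem VanishesOff.smul {S : Set ℝ} {f : CantorL2} (c : ℂ) (hf : VanishesOff S f) :
    VanishesOff S (c • f) := by
  filter_upwards [hf, Lp.coeFn_smul c f] with x h1 h3 hx
  rw [h3, Pi.smul_apply, h1 hx, smul_zero]

theorem vanishesOff_iInter {S : ℕ → Set ℝ} {f : CantorL2} (h : ∀ n, VanishesOff (S n) f) :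
    VanishesOff (⋂ n, S n) f := by
  filter_upwards [ae_all_iff.2 h] with x hx hxS
  simp only [Set.mem_iInter, not_forall] at hxS
  obtain ⟨n, hn⟩ := hxS
  exact hx n hn

theorem VanishesOff.cascade {S : Set ℝ} {f : CantorL2} (h : VanishesOff S f) :
    VanishesOff {x | 3 * x ∈ S ∨ 3 * x - 2 ∈ S} (cascade f) := by
  filter_upwards [coeFn_cascade f, ae_comp_mul_three h,
    ae_comp_mul_three (ae_comp_sub_one (ae_comp_sub_one h))] with x h1 h2 h3 hx
  have e : 3 * x - 1 - 1 = 3 * x - 2 := by ring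
  rw [e] at h3
  replace hx := not_or.1 hx
  rw [h1, h2 hx.1, h3 hx.2, add_zero]

/-- `M` moves supports by the maps `x ↦ x / 3` and `x ↦ (x + 2) / 3`, which send `[0, 1]` into
itself. The overhang `a` beyond `[0, 1]` is therefore divided by `3`, whatever its sign. -/
theorem VanishesOff.cascade_Icc {a : ℝ} {f : CantorL2}
    (h : VanishesOff (Set.Icc (-a) (1 + a)) f) :
    VanishesOff (Set.Icc (-(a / 3)) (1 + a / 3)) (CantorWavelet.cascade f) := by
  refine h.cascade.mono ?_
  rintro x (⟨h1, h2⟩ | ⟨h1, h2⟩) <;> constructor <;> linarith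

theorem HasBoundedSupport.exists_vanishesOff {f : CantorL2} (h : HasBoundedSupport f) :
    ∃ a : ℝ, VanishesOff (Set.Icc (-a) (1 + a)) f := by
  obtain ⟨K, hK, hf⟩ := h
  obtain ⟨r, hr⟩ := hK.subset_closedBall 0
  refine ⟨r, VanishesOff.mono hf fun x hx => ?_⟩
  have h1 := hr hx
  rw [Metric.mem_closedBall, dist_zero_right, Real.norm_eq_abs, abs_le] at h1
  constructor <;> linarith

/-! ### Correlations -/

/-- The correlation coefficients `⟪f, Tᵏ f⟫`. -/
noncomputable def correlation (f : CantorL2) (k : ℤ) : ℂ := inner ℂ f ((translation ^ k) f)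

theorem correlation_zero (f : CantorL2) : correlation f 0 = (‖f‖ : ℂ) ^ 2 := by
  rw [correlation, zpow_zero]
  exact inner_self_eq_norm_sq_to_K f

theorem inner_zpow_zpow (f : CantorL2) (j k : ℤ) :
    inner ℂ ((translation ^ j) f) ((translation ^ k) f) = correlation f (k - j) := by
  have e : (translation ^ k) f = (translation ^ j) ((translation ^ (k - j)) f) := by
    change _ = (translation ^ j * translation ^ (k - j)) f
    rw [← zpow_add, add_sub_cancel]
  rw [e, LinearIsometryEquiv.inner_map_map, correlation]

/-- Moving `Tᵏ` past the isometry `U⁻¹` turns it into `T³ᵏ`. What remains is `|m₀|² = 1 + (z² + z⁻²)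
/ 2`, expanded under the inner product. -/
theorem correlation_cascade (f : CantorL2) (k : ℤ) :
    correlation (cascade f) k =
      correlation f (3 * k) + (correlation f (3 * k + 2) + correlation f (3 * k - 2)) / 2 := by
  have e0 : f = (translation ^ (0 : ℤ)) f := by simp
  have e2 : translation (translation f) = (translation ^ (2 : ℤ)) f := rfl
  have e3 : ∀ j : ℤ, (translation ^ (3 * k)) ((translation ^ j) f) =
      (translation ^ (3 * k + j)) f := by
    intro j
    rw [zpow_add]
    rfl
  have hf : f + translation (translation f) =
      (translation ^ (0 : ℤ)) f + (translation ^ (2 : ℤ)) f := by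
    rw [e2, ← e0]
  rw [correlation, cascade_apply, translation_zpow_dilation_symm,
    LinearIsometryEquiv.inner_map_map, map_smul, inner_smul_left, inner_smul_right, ← mul_assoc,
    hf, map_add, e3, e3, inner_add_left, inner_add_right, inner_add_right, inner_zpow_zpow,
    inner_zpow_zpow, inner_zpow_zpow, inner_zpow_zpow]
  have hc : (starRingEnd ℂ) (1 / √2 : ℂ) * (1 / √2 : ℂ) = 1 / 2 := by
    have : (1 / √2 : ℂ) = ((1 / √2 : ℝ) : ℂ) := by push_cast; rfl
    rw [this, Complex.conj_ofReal, ← Complex.ofReal_mul, div_mul_div_comm,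
      Real.mul_self_sqrt (by norm_num)]
    norm_num
  rw [hc]
  have h1 : 3 * k + 0 - 0 = 3 * k := by ring
  have h2 : 3 * k + 2 - 0 = 3 * k + 2 := by ring
  have h3 : 3 * k + 0 - 2 = 3 * k - 2 := by ring
  have h4 : 3 * k + 2 - 2 = 3 * k := by ring
  rw [h1, h2, h3, h4]
  ring

theorem VanishesOff.exists_correlation_eq_zero {a : ℝ} {f : CantorL2}
    (h : VanishesOff (Set.Icc (-a) (1 + a)) f) :
    ∃ B : ℕ, ∀ k : ℤ, (B : ℤ) + 2 ≤ |k| → correlation f k = 0 := by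
  -- `1 + 2a` is the length of the interval: a longer shift makes the supports disjoint. The extra
  -- `2` in the bound `B + 2` makes `B = 0` the stable range of the later induction.
  obtain ⟨B, hB⟩ := exists_nat_gt (1 + 2 * a)
  refine ⟨B, fun k hk => ?_⟩
  rw [correlation, L2.inner_def]
  apply integral_eq_zero_of_ae
  have hk' : (B : ℝ) + 2 ≤ |(k : ℝ)| := by exact_mod_cast hk
  filter_upwards [h, ae_comp_sub_int k h, coeFn_translation_zpow k f] with x h1 h2 h3
  rw [h3]
  by_cases hx : x ∈ Set.Icc (-a) (1 + a)
  · rw [h2, inner_zero_right]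
    · rfl
    · rintro ⟨h4, h5⟩
      obtain ⟨h6, h7⟩ := hx
      rcases abs_cases (k : ℝ) with h | h <;> linarith
  · rw [h1 hx, inner_zero_left]
    rfl

/-! ### Eventual constancy of the norms -/

/-- If `|k| ≥ 2`, then `3k` and `3k ± 2` all have absolute value at least `4`, so the condition
persists. At `k = 0` only the indices `0` and `±2` enter, and the latter contribute nothing. -/
theorem norm_cascade_of_correlation {f : CantorL2}
    (h : ∀ k : ℤ, 2 ≤ |k| → correlation f k = 0) :
    (∀ k : ℤ, 2 ≤ |k| → correlation (cascade f) k = 0) ∧ ‖cascade f‖ = ‖f‖ := by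
  constructor
  · intro k hk
    rw [correlation_cascade, h, h, h] <;> grind
  · have h0 := correlation_cascade f 0
    rw [mul_zero, h (0 + 2) (by decide), h (0 - 2) (by decide), correlation_zero,
      correlation_zero] at h0
    have h1 : ‖cascade f‖ ^ 2 = ‖f‖ ^ 2 := by
      have : (‖cascade f‖ : ℂ) ^ 2 = (‖f‖ : ℂ) ^ 2 := by simpa using h0
      exact_mod_cast this
    exact (pow_left_inj₀ (norm_nonneg _) (norm_nonneg _) two_ne_zero).1 h1

theorem exists_norm_pow_cascade_eq (B : ℕ) (f : CantorL2)
    (h : ∀ k : ℤ, (B : ℤ) + 2 ≤ |k| → correlation f k = 0) :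
    ∃ N, ∀ n ≥ N, ‖(cascade ^ n) f‖ = ‖(cascade ^ N) f‖ := by
  induction B generalizing f with
  | zero =>
    have hn : ∀ n : ℕ, (∀ k : ℤ, 2 ≤ |k| → correlation ((cascade ^ n) f) k = 0) ∧
        ‖(cascade ^ n) f‖ = ‖f‖ := by
      intro n
      induction n with
      | zero => exact ⟨fun k hk => h k (by simpa using hk), rfl⟩
      | succ n ih =>
        have e : (cascade ^ (n + 1)) f = cascade ((cascade ^ n) f) := by
          rw [pow_succ']; rfl
        have hc := norm_cascade_of_correlation ih.1
        rw [e]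
        exact ⟨hc.1, hc.2.trans ih.2⟩
    exact ⟨0, fun n _ => (hn n).2⟩
  | succ B ih =>
    -- For `|k| ≥ 2` one has `|3k ± 2| ≥ 3|k| - 2 ≥ |k| + 1`, so each application of `M` lowers the
    -- bound by at least one.
    obtain ⟨N, hN⟩ := ih (cascade f) (by
      intro k hk
      rw [correlation_cascade, h, h, h] <;> grind)
    refine ⟨N + 1, fun n hn => ?_⟩
    obtain ⟨m, rfl⟩ : ∃ m, n = m + 1 := ⟨n - 1, by omega⟩
    exact hN m (by omega)

/-! ### Injectivity of the cascade operator on vectors of bounded support. -/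

/-- Since `U⁻¹` is injective, `Mf = 0` means `T²f = -f`, and this is iterated `n` times. -/
theorem correlation_mul_two_of_cascade_eq_zero {f : CantorL2} (h : cascade f = 0) (n : ℕ) :
    correlation f (2 * n) = (-1) ^ n * correlation f 0 := by
  have h0 : f + translation (translation f) = 0 := by
    rw [cascade_apply, LinearIsometryEquiv.map_eq_zero_iff] at h
    refine (smul_eq_zero.1 h).resolve_left ?_
    simp
  have h1 : (translation ^ (2 : ℤ)) f = -f := (neg_eq_of_add_eq_zero_right h0).symm
  induction n with
  | zero => simp
  | succ n ih =>
    have e : (translation ^ (2 * ((n + 1 : ℕ) : ℤ))) f =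
        (translation ^ (2 * (n : ℤ))) ((translation ^ (2 : ℤ)) f) := by
      rw [Nat.cast_succ, mul_add, mul_one, zpow_add]
      rfl
    rw [correlation, e, h1, map_neg, inner_neg_right]
    rw [correlation] at ih
    rw [ih, pow_succ]
    ring

theorem eq_zero_of_cascade_eq_zero {a : ℝ} {f : CantorL2}
    (hf : VanishesOff (Set.Icc (-a) (1 + a)) f) (h : cascade f = 0) : f = 0 := by
  obtain ⟨B, hB⟩ := hf.exists_correlation_eq_zero
  -- `2(B + 1)` is an even index beyond the range of nonzero correlations, while the kernel relation
  -- makes the correlation there equal to `±‖f‖²`.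
  have h1 := hB (2 * (B + 1 : ℕ)) (by rw [abs_of_nonneg (by positivity)]; push_cast; linarith)
  rw [correlation_mul_two_of_cascade_eq_zero h, correlation_zero] at h1
  simpa using h1

theorem VanishesOff.pow_cascade_Icc {a : ℝ} {f : CantorL2}
    (h : VanishesOff (Set.Icc (-a) (1 + a)) f) (n : ℕ) :
    VanishesOff (Set.Icc (-(a / 3 ^ n)) (1 + a / 3 ^ n)) ((CantorWavelet.cascade ^ n) f) := by
  induction n with
  | zero => simpa using h
  | succ n ih =>
    have e : (CantorWavelet.cascade ^ (n + 1)) f =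
        CantorWavelet.cascade ((CantorWavelet.cascade ^ n) f) := by
      rw [pow_succ']; rfl
    rw [e, pow_succ, ← div_div]
    exact ih.cascade_Icc

theorem eq_zero_of_pow_cascade_eq_zero {a : ℝ} {f : CantorL2}
    (hf : VanishesOff (Set.Icc (-a) (1 + a)) f) (n : ℕ) (h : (cascade ^ n) f = 0) : f = 0 := by
  induction n with
  | zero => simpa using h
  | succ n ih =>
    refine ih (eq_zero_of_cascade_eq_zero (hf.pow_cascade_Icc n) ?_)
    rw [pow_succ'] at h
    exact h

/-! ### Fixed vectors of the cascade operator -/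

theorem pow_cascade_of_fixed {f : CantorL2} (h : cascade f = f) (n : ℕ) :
    (cascade ^ n) f = f := by
  induction n with
  | zero => rfl
  | succ n ih =>
    rw [pow_succ]
    change (cascade ^ n) (cascade f) = f
    rw [h, ih]

/-- A fixed vector inherits every support bound valid for its iterates. Shrinking the overhang to
zero gives `[0, 1]`, and pulling `[0, 1]` back repeatedly gives each `preCantorSet n`, whose
intersection is `C`. -/
theorem VanishesOff.cantorSet_of_fixed {a : ℝ} {f : CantorL2}
    (hf : VanishesOff (Set.Icc (-a) (1 + a)) f) (h : CantorWavelet.cascade f = f) :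
    VanishesOff cantorSet f := by
  have h01 : VanishesOff (Set.Icc 0 1) f := by
    have hn : ∀ n : ℕ, VanishesOff (Set.Icc (-(a / 3 ^ n)) (1 + a / 3 ^ n)) f := by
      intro n
      have := hf.pow_cascade_Icc n
      rwa [pow_cascade_of_fixed h] at this
    refine (vanishesOff_iInter hn).mono fun x hx => ?_
    rw [Set.mem_iInter] at hx
    have hlim : Tendsto (fun n : ℕ => a / (3 : ℝ) ^ n) atTop (𝓝 0) :=
      tendsto_const_nhds.div_atTop (tendsto_pow_atTop_atTop_of_one_lt (by norm_num))
    constructor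
    · refine le_of_tendsto' (f := fun n : ℕ => -(a / (3 : ℝ) ^ n)) (x := atTop) ?_
        fun n => (hx n).1
      simpa using hlim.neg
    · refine ge_of_tendsto' (f := fun n : ℕ => 1 + a / (3 : ℝ) ^ n) (x := atTop) ?_
        fun n => (hx n).2
      simpa using hlim.const_add 1
  refine vanishesOff_iInter fun n => ?_
  induction n with
  | zero => simpa using h01
  | succ n ih =>
    have hc := ih.cascade
    rw [h] at hc
    refine hc.mono ?_
    rintro x (hx | hx)
    · exact Or.inl ⟨3 * x, hx, by ring⟩
    · exact Or.inr ⟨3 * x - 2, hx, by ring⟩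

/-! ### Finiteness of the measure of the Cantor set -/

theorem exists_cover_preCantorSet (n : ℕ) :
    ∃ s : Finset ℝ, s.card ≤ 2 ^ n ∧ preCantorSet n ⊆ ⋃ a : s, Set.Icc (a : ℝ) (a + (3 ^ n)⁻¹) := by
  classical
  induction n with
  | zero => exact ⟨{0}, by simp, fun x hx => Set.mem_iUnion.2
      ⟨⟨0, Finset.mem_singleton_self 0⟩, by simpa using hx⟩⟩
  | succ n ih =>
    obtain ⟨s, hs, hc⟩ := ih
    refine ⟨s.image (· / 3) ∪ s.image fun a => (2 + a) / 3, ?_, ?_⟩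
    · calc _ ≤ _ := Finset.card_union_le _ _
        _ ≤ s.card + s.card := add_le_add Finset.card_image_le Finset.card_image_le
        _ ≤ 2 ^ (n + 1) := by rw [pow_succ]; omega
    · have e : ((3 : ℝ) ^ (n + 1))⁻¹ = (3 ^ n)⁻¹ / 3 := by
        rw [pow_succ, mul_inv, div_eq_mul_inv]
      rw [preCantorSet_succ, e]
      rintro _ (⟨y, hy, rfl⟩ | ⟨y, hy, rfl⟩)
      · obtain ⟨⟨b, hb⟩, h1, h2⟩ := Set.mem_iUnion.1 (hc hy)
        refine Set.mem_iUnion.2 ⟨⟨b / 3, Finset.mem_union_left _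
          (Finset.mem_image_of_mem _ hb)⟩, ?_, ?_⟩ <;> simp only at h1 h2 ⊢ <;> linarith
      · obtain ⟨⟨b, hb⟩, h1, h2⟩ := Set.mem_iUnion.1 (hc hy)
        refine Set.mem_iUnion.2 ⟨⟨(2 + b) / 3, Finset.mem_union_right _
          (Finset.mem_image_of_mem _ hb)⟩, ?_, ?_⟩ <;> simp only at h1 h2 ⊢ <;> linarith

/-- At level `n` there are at most `2ⁿ` intervals of length `3⁻ⁿ`, each contributing `(3⁻ⁿ)ˢ = 2⁻ⁿ`.
-/
theorem hausdorffMeasure_cantorSet_le : Measure.hausdorffMeasure cantorDim cantorSet ≤ 1 := by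
  choose s hs hc using exists_cover_preCantorSet
  have hd : ∀ (n : ℕ) (a : s n), Metric.ediam (Set.Icc (a : ℝ) (a + (3 ^ n)⁻¹)) =
      ENNReal.ofReal ((3 ^ n)⁻¹) := by
    intro n a
    rw [Real.ediam_Icc, add_sub_cancel_left]
  have hr : Tendsto (fun n : ℕ => ENNReal.ofReal (((3 : ℝ) ^ n)⁻¹)) atTop (𝓝 0) := by
    rw [← ENNReal.ofReal_zero]
    exact ENNReal.tendsto_ofReal (tendsto_inv_atTop_zero.comp
      (tendsto_pow_atTop_atTop_of_one_lt (by norm_num)))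
  refine (Measure.hausdorffMeasure_le_liminf_sum cantorDim cantorSet
    (fun n : ℕ => ENNReal.ofReal (((3 : ℝ) ^ n)⁻¹)) hr
    (fun n (a : s n) => Set.Icc (a : ℝ) (a + (3 ^ n)⁻¹))
    (Eventually.of_forall fun n a => (hd n a).le)
    (Eventually.of_forall fun n => (Set.iInter_subset _ n).trans (hc n))).trans ?_
  refine (liminf_le_liminf (v := fun _ => (1 : ℝ≥0∞)) (Eventually.of_forall fun n => ?_)).trans
    (liminf_const _).le
  have hp : ENNReal.ofReal (((3 : ℝ) ^ n)⁻¹) ^ cantorDim = ((2 : ℝ≥0∞) ^ n)⁻¹ := by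
    have h3 : ((3 : ℝ) ^ n)⁻¹ ^ cantorDim = ((2 : ℝ) ^ n)⁻¹ := by
      rw [Real.inv_rpow (by positivity), ← Real.rpow_natCast, ← Real.rpow_mul (by norm_num),
        mul_comm, Real.rpow_mul (by norm_num), cantorDim,
        Real.rpow_logb (by norm_num) (by norm_num) (by norm_num), Real.rpow_natCast]
    rw [ENNReal.ofReal_rpow_of_nonneg (by positivity) cantorDim_nonneg, h3,
      ENNReal.ofReal_inv_of_pos (by positivity), ENNReal.ofReal_pow (by norm_num)]
    norm_num
  simp only [hd, hp, Finset.sum_const, Finset.card_univ, Fintype.card_coe, nsmul_eq_mul]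
  rw [← div_eq_mul_inv]
  refine ENNReal.div_le_of_le_mul ?_
  rw [one_mul]
  exact_mod_cast hs n

theorem cantorMeasure_cantorSet_ne_top : cantorMeasure cantorSet ≠ ∞ :=
  ((Measure.restrict_apply_le _ _).trans hausdorffMeasure_cantorSet_le).trans_lt
    ENNReal.one_lt_top |>.ne

/-! ### Integrals of fixed vectors -/

/-- The factor `1 / 2` is `3⁻ˢ`, the scaling of the measure under `x ↦ 3x`. -/
theorem setIntegral_comp_mul_three (g : ℝ → ℂ) (t : ℝ) :
    ∫ x in Set.Iic t, g (3 * x) ∂cantorMeasure =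
      (∫ x in Set.Iic (3 * t), g x ∂cantorMeasure) / 2 := by
  have h := (MeasurableEquiv.mulRight₀ (3 : ℝ)⁻¹ (by norm_num)).measurableEmbedding.setIntegral_map
    (μ := cantorMeasure) (fun x => g (3 * x)) (Set.Iic t)
  have hpre : (MeasurableEquiv.mulRight₀ (3 : ℝ)⁻¹ (by norm_num)) ⁻¹' (Set.Iic t) =
      Set.Iic (3 * t) := by
    ext x
    simp only [Set.mem_preimage, MeasurableEquiv.coe_mulRight₀, Set.mem_Iic]
    constructor <;> intro h <;> linarith
  rw [hpre, map_div_three_cantorMeasure, Measure.restrict_smul, integral_smul_measure] at h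
  simp only [MeasurableEquiv.coe_mulRight₀] at h
  have h3 : ∀ x : ℝ, 3 * (x * 3⁻¹) = x := fun x => by ring
  simp only [h3] at h
  rw [← h]
  have h2 : (ENNReal.ofReal ((1 / √2 : ℝ)⁻¹ ^ 2)).toReal = 2 := by simp
  rw [h2, Complex.real_smul]
  push_cast
  ring

theorem setIntegral_comp_sub_one (g : ℝ → ℂ) (t : ℝ) :
    ∫ x in Set.Iic t, g (x - 1) ∂cantorMeasure = ∫ x in Set.Iic (t - 1), g x ∂cantorMeasure := by
  have h := (MeasurableEquiv.addRight (-1 : ℝ)).measurableEmbedding.setIntegral_map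
    (μ := cantorMeasure) g (Set.Iic (t - 1))
  have hpre : (MeasurableEquiv.addRight (-1 : ℝ)) ⁻¹' (Set.Iic (t - 1)) = Set.Iic t := by
    ext x
    simp only [Set.mem_preimage, MeasurableEquiv.coe_addRight, Set.mem_Iic]
    constructor <;> intro h <;> linarith
  rw [hpre, map_sub_one_cantorMeasure, inv_one, one_pow, ENNReal.ofReal_one, one_smul] at h
  simpa [← sub_eq_add_neg] using h.symm

theorem integrable_of_vanishesOff_cantorSet {f : CantorL2} (h : VanishesOff cantorSet f) :
    Integrable f cantorMeasure := by
  have : IsFiniteMeasure (cantorMeasure.restrict cantorSet) :=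
    isFiniteMeasure_restrict.2 cantorMeasure_cantorSet_ne_top
  have h1 : IntegrableOn f cantorSet cantorMeasure :=
    ((Lp.memLp f).restrict cantorSet).integrable (by norm_num)
  exact h1.integrable_of_ae_notMem_eq_zero h

theorem integrable_comp_mul_three {g : ℝ → ℂ} (hg : Integrable g cantorMeasure) :
    Integrable (fun x => g (3 * x)) cantorMeasure := by
  have h := map_symm_equiv _ _ (by positivity) map_div_three_cantorMeasure
  have h1 := (integrable_map_equiv (MeasurableEquiv.mulRight₀ (3 : ℝ)⁻¹ (by norm_num)).symm g
    (μ := cantorMeasure)).1 (by rw [h]; exact hg.smul_measure (by simp))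
  refine h1.congr (ae_of_all _ fun x => ?_)
  have e : (MeasurableEquiv.mulRight₀ (3 : ℝ)⁻¹ (by norm_num)).symm x = 3 * x := by
    rw [MeasurableEquiv.symm_apply_eq]
    simp [mul_comm]
  rw [Function.comp_apply, e]

theorem integrable_comp_sub_one {g : ℝ → ℂ} (hg : Integrable g cantorMeasure) :
    Integrable (fun x => g (x - 1)) cantorMeasure := by
  have h1 := (integrable_map_equiv (MeasurableEquiv.addRight (-1 : ℝ)) g
    (μ := cantorMeasure)).1
    (by rw [map_sub_one_cantorMeasure]; exact hg.smul_measure (by simp))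
  simpa [Function.comp_def, ← sub_eq_add_neg] using h1

/-- The distribution function of a fixed vector of the cascade operator satisfies the two-scale
relation of the Cantor function. -/
theorem setIntegral_Iic_of_fixed {f : CantorL2} (hf : Integrable f cantorMeasure)
    (h : cascade f = f) (t : ℝ) :
    ∫ x in Set.Iic t, f x ∂cantorMeasure =
      ((∫ x in Set.Iic (3 * t), f x ∂cantorMeasure) +
        ∫ x in Set.Iic (3 * t - 2), f x ∂cantorMeasure) / 2 := by
  have h2 : Integrable (fun x => f (x - 2)) cantorMeasure := by
    have := integrable_comp_sub_one (integrable_comp_sub_one hf)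
    refine this.congr (ae_of_all _ fun x => ?_)
    change f (x - 1 - 1) = f (x - 2)
    congr 1
    ring
  have hi : ∫ x in Set.Iic (3 * t), f (x - 2) ∂cantorMeasure =
      ∫ x in Set.Iic (3 * t - 2), f x ∂cantorMeasure := by
    have e : 3 * t - 2 = 3 * t - 1 - 1 := by ring
    rw [e, ← setIntegral_comp_sub_one, ← setIntegral_comp_sub_one (fun x => f (x - 1))]
    refine integral_congr_ae (ae_of_all _ fun x => ?_)
    change f (x - 2) = f (x - 1 - 1)
    congr 1
    ring
  have hM : f =ᵐ[cantorMeasure] fun x => f (3 * x) + f (3 * x - 2) := by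
    have := coeFn_cascade f
    rwa [h] at this
  rw [integral_congr_ae (ae_restrict_of_ae hM), integral_add
    (integrable_comp_mul_three hf).integrableOn (integrable_comp_mul_three h2).integrableOn,
    setIntegral_comp_mul_three, setIntegral_comp_mul_three (fun x => f (x - 2)), hi]
  ring

/-- The half-lines form a π-system generating the Borel sets. The total integral `h0` handles
complements. -/
theorem eq_zero_of_setIntegral_Iic_eq_zero {μ : Measure ℝ} {f : ℝ → ℂ} (hf : Integrable f μ)
    (h0 : ∫ x, f x ∂μ = 0) (h : ∀ t, ∫ x in Set.Iic t, f x ∂μ = 0) : f =ᵐ[μ] 0 := by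
  suffices hs : ∀ s, MeasurableSet s → ∫ x in s, f x ∂μ = 0 from
    hf.ae_eq_zero_of_forall_setIntegral_eq_zero fun s h _ => hs s h
  intro s hs
  induction s, hs using MeasurableSpace.induction_on_inter
    ((BorelSpace.measurable_eq (α := ℝ)).trans (borel_eq_generateFrom_Iic ℝ)) isPiSystem_Iic with
  | empty => simp
  | basic s hs =>
    obtain ⟨t, rfl⟩ := hs
    exact h t
  | compl s hs ih => simpa [ih, h0] using integral_add_compl hs hf
  | iUnion s hd hs ih =>
    have := hasSum_integral_iUnion hs hd hf.integrableOn
    simp only [ih] at this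
    exact this.unique hasSum_zero

/-- With total mass zero the distribution function vanishes outside `[0, 1)`. The two-scale relation
then halves its supremum, which must be zero. -/
theorem eq_zero_of_fixed {f : CantorL2} (hC : VanishesOff cantorSet f) (h : cascade f = f)
    (h0 : ∫ x, f x ∂cantorMeasure = 0) : f = 0 := by
  have hf := integrable_of_vanishesOff_cantorSet hC
  have h01 := hC.mono cantorSet_subset_unitInterval
  have hneg : ∀ t < 0, ∫ x in Set.Iic t, f x ∂cantorMeasure = 0 := by
    intro t ht
    refine setIntegral_eq_zero_of_ae_eq_zero ?_
    filter_upwards [h01] with x hx hxt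
    exact hx fun h => by
      have := h.1
      rw [Set.mem_Iic] at hxt
      linarith
  have hone : ∀ t ≥ 1, ∫ x in Set.Iic t, f x ∂cantorMeasure = 0 := by
    intro t ht
    rw [setIntegral_eq_integral_of_ae_compl_eq_zero, h0]
    filter_upwards [h01] with x hx hxt
    exact hx fun h => hxt (h.2.trans ht)
  have hbound : ∀ (n : ℕ) (t : ℝ), ‖∫ x in Set.Iic t, f x ∂cantorMeasure‖ ≤
      (∫ x, ‖f x‖ ∂cantorMeasure) / 2 ^ n := by
    intro n
    induction n with
    | zero =>
      intro t
      rw [pow_zero, div_one]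
      exact (norm_integral_le_integral_norm _).trans
        (setIntegral_le_integral hf.norm (ae_of_all _ fun x => norm_nonneg _))
    | succ n ih =>
      intro t
      rw [setIntegral_Iic_of_fixed hf h, pow_succ, ← div_div, norm_div, Complex.norm_ofNat]
      gcongr
      -- One of the two terms always drops out: `3t - 2 < 0` on the left half, `3t ≥ 1` on the right
      -- half. The bound is uniform in `t`, so it applies to the surviving argument.
      rcases le_total t (1 / 2) with ht | ht
      · rw [hneg (3 * t - 2) (by linarith), add_zero]
        exact ih _
      · rw [hone (3 * t) (by linarith), zero_add]
        exact ih _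
  have hz : ∀ t, ∫ x in Set.Iic t, f x ∂cantorMeasure = 0 := by
    intro t
    have hlim : Tendsto (fun n : ℕ => (∫ x, ‖f x‖ ∂cantorMeasure) / (2 : ℝ) ^ n) atTop (𝓝 0) :=
      tendsto_const_nhds.div_atTop (tendsto_pow_atTop_atTop_of_one_lt (by norm_num))
    exact norm_le_zero_iff.1 (ge_of_tendsto' hlim fun n => hbound n t)
  exact (Lp.eq_zero_iff_ae_eq_zero).2 (eq_zero_of_setIntegral_Iic_eq_zero hf h0 hz)

/-! ### The indicator of the Cantor set and uniqueness of the fixed vector. -/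

/-- The characteristic function of the Cantor set. -/
noncomputable def cantorIndicator : CantorL2 :=
  indicatorConstLp 2 isClosed_cantorSet.measurableSet cantorMeasure_cantorSet_ne_top 1

theorem coeFn_cantorIndicator :
    cantorIndicator =ᵐ[cantorMeasure] cantorSet.indicator fun _ => (1 : ℂ) :=
  indicatorConstLp_coeFn

theorem vanishesOff_cantorIndicator : VanishesOff cantorSet cantorIndicator := by
  filter_upwards [coeFn_cantorIndicator] with x hx hxC
  rw [hx, Set.indicator_of_notMem hxC]

/-- This is the self-similarity of `C`; the two pieces are disjoint because `3x ≤ 1` and `3x ≥ 2`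
exclude each other. -/
theorem indicator_cantorSet_eq_add (x : ℝ) :
    cantorSet.indicator (fun _ => (1 : ℂ)) x =
      cantorSet.indicator (fun _ => (1 : ℂ)) (3 * x) +
        cantorSet.indicator (fun _ => (1 : ℂ)) (3 * x - 2) := by
  have hiff : x ∈ cantorSet ↔ 3 * x ∈ cantorSet ∨ 3 * x - 2 ∈ cantorSet := by
    conv_lhs => rw [cantorSet_eq_union_halves]
    refine or_congr ⟨?_, fun h => ⟨_, h, by ring⟩⟩ ⟨?_, fun h => ⟨_, h, by ring⟩⟩
    · rintro ⟨y, hy, rfl⟩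
      convert hy using 1
      ring
    · rintro ⟨y, hy, rfl⟩
      convert hy using 1
      ring
  have hnot : ¬ (3 * x ∈ cantorSet ∧ 3 * x - 2 ∈ cantorSet) := by
    rintro ⟨h1, h2⟩
    have h3 := (cantorSet_subset_unitInterval h1).2
    have h4 := (cantorSet_subset_unitInterval h2).1
    linarith
  by_cases h1 : 3 * x ∈ cantorSet <;> by_cases h2 : 3 * x - 2 ∈ cantorSet <;>
    simp_all [Set.indicator]

theorem cascade_cantorIndicator : cascade cantorIndicator = cantorIndicator := by
  apply Lp.ext
  filter_upwards [coeFn_cascade cantorIndicator, coeFn_cantorIndicator,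
    ae_comp_mul_three coeFn_cantorIndicator,
    ae_comp_mul_three (ae_comp_sub_int 2 coeFn_cantorIndicator)] with x h1 h2 h3 h4
  push_cast at h4
  rw [h1, h2, h3, h4, indicator_cantorSet_eq_add x]

theorem isMultipleOfCantorIndicator_of_fixed {f : CantorL2} (hb : HasBoundedSupport f)
    (h : cascade f = f) : IsMultipleOfCantorIndicator f := by
  obtain ⟨a, ha⟩ := hb.exists_vanishesOff
  have hC := ha.cantorSet_of_fixed h
  -- If `C` were null, `f` would vanish almost everywhere. Treating this case separately makes a
  -- proof that `C` has positive measure unnecessary.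
  by_cases hm : cantorMeasure cantorSet = 0
  · refine ⟨0, ?_⟩
    filter_upwards [hC, measure_eq_zero_iff_ae_notMem.1 hm] with x h1 h2
    rw [h1 h2, zero_mul]
  set m : ℂ := ∫ x, cantorIndicator x ∂cantorMeasure with hmdef
  have hm0 : m ≠ 0 := by
    rw [hmdef, integral_congr_ae coeFn_cantorIndicator,
      integral_indicator isClosed_cantorSet.measurableSet, setIntegral_const]
    simp [Measure.real, ENNReal.toReal_eq_zero_iff, hm, cantorMeasure_cantorSet_ne_top]
  -- This `c` gives `f - c • cantorIndicator` total integral zero, as `eq_zero_of_fixed` requires.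
  set c : ℂ := (∫ x, f x ∂cantorMeasure) / m
  have hg : f - c • cantorIndicator = 0 := by
    apply eq_zero_of_fixed (hC.sub (vanishesOff_cantorIndicator.smul c))
    · rw [map_sub, map_smul, h, cascade_cantorIndicator]
    · have e : (f - c • cantorIndicator : CantorL2) =ᵐ[cantorMeasure]
          fun x => f x - c • (cantorIndicator x : ℂ) := by
        filter_upwards [Lp.coeFn_sub f (c • cantorIndicator), Lp.coeFn_smul c cantorIndicator]
          with x h1 h2
        rw [h1, Pi.sub_apply, h2, Pi.smul_apply]
      have hi : Integrable (fun x => c • (cantorIndicator x : ℂ)) cantorMeasure :=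
        (integrable_of_vanishesOff_cantorSet vanishesOff_cantorIndicator).smul c
      rw [integral_congr_ae e, integral_sub (integrable_of_vanishesOff_cantorSet hC) hi,
        integral_smul, smul_eq_mul, ← hmdef, div_mul_cancel₀ _ hm0, sub_self]
  refine ⟨c, ?_⟩
  rw [sub_eq_zero.1 hg]
  filter_upwards [Lp.coeFn_smul c cantorIndicator, coeFn_cantorIndicator] with x h1 h2
  rw [h1, Pi.smul_apply, h2, smul_eq_mul]

end CantorWavelet

/-! ### Proof of the main theorem. -/

open CantorWavelet in
theorem proposition3p7 (ξ : CantorL2) (hbdd : HasBoundedSupport ξ)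
    (hξ : ¬ IsMultipleOfCantorIndicator ξ) :
    (∃ c : ℝ, 0 < c ∧
      Filter.Tendsto (fun n : ℕ => ‖(cascade ^ (n + 1)) ξ - (cascade ^ n) ξ‖ ^ 2)
        Filter.atTop (nhds c)) ∧
    ¬ ∃ η : CantorL2,
      Filter.Tendsto (fun n : ℕ => (cascade ^ n) ξ) Filter.atTop (nhds η) := by
  have hdiff : ∀ n : ℕ, (cascade ^ (n + 1)) ξ - (cascade ^ n) ξ =
      (cascade ^ n) (cascade ξ - ξ) := by
    intro n
    rw [map_sub, pow_succ]
    rfl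
  obtain ⟨a, ha⟩ := hbdd.exists_vanishesOff
  -- With `|a|` in place of `a`, the contracted interval supporting `Mξ` lies inside the one
  -- supporting `ξ`; for negative `a` it would not.
  have hvan : VanishesOff (Set.Icc (-|a|) (1 + |a|)) (cascade ξ - ξ) := by
    have hsub : Set.Icc (-a) (1 + a) ⊆ Set.Icc (-|a|) (1 + |a|) :=
      Set.Icc_subset_Icc (neg_le_neg (le_abs_self a)) (by linarith [le_abs_self a])
    have h1 := ha.mono hsub
    refine (h1.cascade_Icc.mono ?_).sub h1
    have := abs_nonneg a
    exact Set.Icc_subset_Icc (by linarith) (by linarith)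
  obtain ⟨B, hB⟩ := hvan.exists_correlation_eq_zero
  obtain ⟨N, hN⟩ := exists_norm_pow_cascade_eq B _ hB
  have hpos : 0 < ‖(cascade ^ N) (cascade ξ - ξ)‖ := by
    rw [norm_pos_iff]
    intro h0
    exact hξ (isMultipleOfCantorIndicator_of_fixed hbdd
      (sub_eq_zero.1 (eq_zero_of_pow_cascade_eq_zero hvan N h0)))
  have hlim : Tendsto (fun n : ℕ => ‖(cascade ^ (n + 1)) ξ - (cascade ^ n) ξ‖ ^ 2) atTop
      (𝓝 (‖(cascade ^ N) (cascade ξ - ξ)‖ ^ 2)) := by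
    refine tendsto_const_nhds.congr' ?_
    filter_upwards [eventually_ge_atTop N] with n hn
    rw [hdiff, hN n hn]
  refine ⟨⟨_, by positivity, hlim⟩, ?_⟩
  rintro ⟨η, hη⟩
  -- Convergence would force the squared increments to tend to `0`, against their positive limit.
  have h1 := (((tendsto_add_atTop_iff_nat 1).2 hη).sub hη).norm.pow 2
  have h2 := tendsto_nhds_unique hlim h1
  rw [sub_self, norm_zero] at h2
  have : 0 < ‖(cascade ^ N) (cascade ξ - ξ)‖ ^ 2 := by positivity
  rw [h2] at this
  norm_num at this
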